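/- Let $n\ge 2$, let $A^*\in\mathbb{R}^{n\times n}$ satisfy $\sum_{j}|a^*_{ij}|>0$ for every $i$, and let $c^*\in\mathbb{R}^n$. Let $(D_{t,i})_{t\ge 1,\,1\le i\le n}$ be i.i.d. standard normal random variables and let $S_0$ be a $\{0,1\}^n$-valued random vector, of arbitrary distribution, independent of $(D_{t,i})$. For $t\ge 1$ define $$Y_t=A^*S_{t-1}+D_t,\qquad S_{t,i}=\begin{cases}1,& Y_{t,i}>c^*_i,\\ 0,&\text{otherwise,}\end{cases}\quad 1\le i\le n,$$ and $\tilde S_t=(S_t^T, S_{t-1}^T)^T\in\{0,1\}^{2n}$. Write a parameter vector as $\theta=(\theta^{(1)},\dots,\theta^{(n)})\in(\mathbb{R}^{n+1})^n$ with $\theta^{(i)}=(A_i,c_i)$, $A_i\in\mathbb{R}^n$, $c_i\in\mathbb{R}$, and let $\theta^*$ be the true parameter, with $(\theta^*)^{(i)}=(A^*_i,c^*_i)$. Let $\Phi$ be the standard normal distribution function and, for $\tilde x\in\{0,1\}^{2n}$ whose last $n$ entries form the vector $x$, let $$g_i(\tilde x\mid\theta^{(i)})=\bigl(1-\Phi(c_i-A_ix)\bigr)^{\tilde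 x_i}\,\Phi(c_i-A_ix)^{1-\tilde x_i},\qquad K(\theta,\tilde x)=\bigl(\nabla_{\theta^{(i)}}\log g_i(\tilde x\mid\theta^{(i)})\bigr)_{1\le i\le n}.$$ Let $(a_t)_{t\ge 1}$ be real numbers with $a_t>0$, $\sum_{t\ge 1}a_t=\infty$ and $\sum_{t\ge 1}a_t^2<\infty$. Let $\theta_1$ be any fixed (non-random) vector, and let $$\theta_{t+1}=\theta_t+a_tK(\theta_t,\tilde S_{t+1}),\qquad t\ge 1.$$ Assume that almost surely the sequence $(\theta_t)_{t\ge 1}$ is bounded (by a bound that may be random). Then $\theta_t\to\theta^*$ almost surely as $t\to\infty$. -/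

import Mathlib

open MeasureTheory ProbabilityTheory Filter Topology

noncomputable section

namespace BinaryNetwork

/-- The binary configurations `{0,1}^n`. -/
abbrev Config (n : ℕ) : Type := Fin n → Fin 2

/-- The extended configurations `{0,1}^{2n}`: the coordinates `Sum.inl i` are the first `n`
entries and the coordinates `Sum.inr i` are the last `n` entries. -/
abbrev ExtConfig (n : ℕ) : Type := Fin n ⊕ Fin n → Fin 2

/-- The space `ℝ^(n+1)` of one row `θ⁽ⁱ⁾ = (A_i, c_i)` of the parameter: the coordinates
`0, …, n-1` are the weights and the coordinate `n` is the threshold. -/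
abbrev RowParam (n : ℕ) : Type := EuclideanSpace ℝ (Fin (n + 1))

/-- The parameter space `ℝ^(n(n+1))`, as the stack of its `n` rows. -/
abbrev Param (n : ℕ) : Type := Fin n → RowParam n

/-- A binary configuration as a real vector. -/
def realVec {n : ℕ} (s : Config n) : Fin n → ℝ := fun j => ((s j : ℕ) : ℝ)

/-- The quantizer `Q(y, c)`, with `i`-th entry `1` if `y_i > c_i` and `0` otherwise. -/
def quantizer {n : ℕ} (y c : Fin n → ℝ) : Config n :=
  fun i => open Classical in if y i > c i then 1 else 0

/-- The model `Y_t = A S_{t-1} + D_t`, `S_t = Q(Y_t, c)`, for all `t ≥ 1`. -/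
structure IsBinaryModel {n : ℕ} {Ω : Type*} (A : Matrix (Fin n) (Fin n) ℝ) (c : Fin n → ℝ)
    (D Y : ℕ → Ω → Fin n → ℝ) (S : ℕ → Ω → Config n) : Prop where
  state : ∀ t, 1 ≤ t → ∀ ω, Y t ω = A.mulVec (realVec (S (t - 1) ω)) + D t ω
  observation : ∀ t, 1 ≤ t → ∀ ω, S t ω = quantizer (Y t ω) c

/-- The variables `D_{t,i}`, `t ≥ 1`, `1 ≤ i ≤ n`, are i.i.d. standard normal. -/
structure IsStandardNormalNoise {n : ℕ} {Ω : Type*} [MeasurableSpace Ω] (μ : Measure Ω)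
    (D : ℕ → Ω → Fin n → ℝ) : Prop where
  measurable : ∀ t, 1 ≤ t → ∀ i, Measurable (fun ω => D t ω i)
  law : ∀ t, 1 ≤ t → ∀ i, μ.map (fun ω => D t ω i) = gaussianReal 0 1
  indep : iIndepFun (fun (p : ℕ × Fin n) (ω : Ω) => D (p.1 + 1) ω p.2) μ

/-- The initial observation `S_0` is a random vector that is independent of the whole noise
`(D_{t,i})`, `t ≥ 1`, `1 ≤ i ≤ n`. Its distribution is arbitrary. -/
structure IsInitialObservation {n : ℕ} {Ω : Type*} [MeasurableSpace Ω] (μ : Measure Ω)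
    (D : ℕ → Ω → Fin n → ℝ) (S₀ : Ω → Config n) : Prop where
  measurable : Measurable S₀
  indep : IndepFun S₀ (fun (ω : Ω) (p : ℕ × Fin n) => D (p.1 + 1) ω p.2) μ

/-- The step sizes: `a_t > 0` for `t ≥ 1`, `∑_{t ≥ 1} a_t = ∞` and `∑_{t ≥ 1} a_t² < ∞`. -/
structure IsStepSize (a : ℕ → ℝ) : Prop where
  pos : ∀ t, 1 ≤ t → 0 < a t
  sum_eq_top : Tendsto (fun T : ℕ => ∑ t ∈ Finset.Icc 1 T, a t) atTop atTop
  summable_sq : Summable (fun t : ℕ => a (t + 1) ^ 2)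

/-- `vec (A c)`: the parameter whose `i`-th row is `(A_i, c_i)`. -/
def vecParam {n : ℕ} (A : Matrix (Fin n) (Fin n) ℝ) (c : Fin n → ℝ) : Param n :=
  fun i => WithLp.toLp 2 (Fin.snoc (α := fun _ => ℝ) (A i) (c i))

/-- The distribution function of the standard normal law. -/
def Phi (x : ℝ) : ℝ := cdf (gaussianReal 0 1) x

/-- The conditional likelihood of the `i`-th observation,
`g_i(x̃ | θ⁽ⁱ⁾) = (1 - Φ(c_i - A_i x))^(x̃_i) Φ(c_i - A_i x)^(1 - x̃_i)`,
where `x` consists of the last `n` entries of `x̃`. -/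
def g {n : ℕ} (i : Fin n) (x : ExtConfig n) (η : RowParam n) : ℝ :=
  let z : ℝ := η (Fin.last n) - ∑ j : Fin n, η j.castSucc * ((x (Sum.inr j) : ℕ) : ℝ)
  (1 - Phi z) ^ (x (Sum.inl i) : ℕ) * Phi z ^ (1 - (x (Sum.inl i) : ℕ))

/-- `K(θ, x̃)`, with `i`-th block `K_i(θ⁽ⁱ⁾, x̃) = ∇_{θ⁽ⁱ⁾} log g_i(x̃ | θ⁽ⁱ⁾)`. -/
def K {n : ℕ} (θ : Param n) (x : ExtConfig n) : Param n :=
  fun i => gradient (fun η : RowParam n => Real.log (g i x η)) (θ i)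

/-- The extended observation `S̃_t = (S_t, S_{t-1})`, for `t ≥ 1`. -/
def extObs {n : ℕ} {Ω : Type*} (S : ℕ → Ω → Config n) (t : ℕ) (ω : Ω) : ExtConfig n :=
  Sum.elim (S t ω) (S (t - 1) ω)

/-- The stochastic approximation recursion `θ_{t+1} = θ_t + a_t K(θ_t, S̃_{t+1})`, `t ≥ 1`,
started from the fixed value `θ_1 = θinit`. -/
structure IsEstimate {n : ℕ} {Ω : Type*} (a : ℕ → ℝ) (S : ℕ → Ω → Config n)
    (θinit : Param n) (θ : ℕ → Ω → Param n) : Prop where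
  init : ∀ ω, θ 1 ω = θinit
  step : ∀ t, 1 ≤ t → ∀ ω, θ (t + 1) ω = θ t ω + a t • K (θ t ω) (extObs S (t + 1) ω)

end BinaryNetwork

end

/-! The rows of the parameter decouple. Fix `i`, let `u t` be the error of row `i` and `v t = (-S,
1)` the current covector, so that `c_i - A_i x` is an inner product with the covector of `x`. The
score is a scalar multiple of `v t` and splits into its conditional mean under the true parameter
and a centred noise. Since `Phi` is strictly increasing, the mean part pulls `⟪v t, u t⟫` towards
zero, and on bounded sets it does so at least linearly (`exists_mul_sq_le_scoreWeight_mul`). This is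
where boundedness of the estimates enters.

Hence `‖u t‖ ^ 2` is a Lyapunov function. The noise sums to a convergent martingale because `∑ a_t²`
is finite, so `‖u t‖ ^ 2` converges and `∑ a_t ⟪v t, u t⟫²` is finite
(`tendsto_norm_sq_and_summable_of_descent`).

This controls `u t` only along the visited covector. The error moves by `O(a_t)` per step, so the
next covector may be paired with the present error (`summable_inner_sq_shift`). Every configuration
comes next with conditional probability at least some `ε > 0`, so a second martingale comparison
gives summability against every fixed covector (`summable_of_summable_mul_of_tendsto`). The
covectors span, so `∑ a_t ‖u t‖²` is finite. As `∑ a_t` diverges, the limit of `‖u t‖ ^ 2` must be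
zero. No ergodic theorem or ODE method is needed. -/

noncomputable section

namespace BinaryNetwork

/-! ### The probit score and its monotonicity. -/

section Probit

local notation "φ" => gaussianPDFReal 0 1

theorem continuous_gaussianPDFReal : Continuous φ := by
  unfold gaussianPDFReal; fun_prop

theorem Phi_sub_Phi (x y : ℝ) : Phi y - Phi x = ∫ t in x..y, φ t := by
  have h (x : ℝ) : Phi x = ∫ t in Set.Iic x, φ t := by
    rw [Phi, cdf_eq_real, measureReal_def, gaussianReal_apply_eq_integral _ one_ne_zero,
      ENNReal.toReal_ofReal]
    exact setIntegral_nonneg measurableSet_Iic fun t _ => gaussianPDFReal_nonneg _ _ _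
  rw [h, h, intervalIntegral.integral_Iic_sub_Iic] <;>
    exact (integrable_gaussianPDFReal 0 1).integrableOn

theorem hasDerivAt_Phi (x : ℝ) : HasDerivAt Phi (φ x) x := by
  have h : Phi = fun y => Phi 0 + ∫ t in (0 : ℝ)..y, φ t := by
    ext y; rw [← Phi_sub_Phi]; ring
  rw [h]
  exact (intervalIntegral.integral_hasDerivAt_right
    (continuous_gaussianPDFReal.intervalIntegrable _ _)
    (continuous_gaussianPDFReal.stronglyMeasurableAtFilter _ _)
    continuous_gaussianPDFReal.continuousAt).const_add _

theorem continuous_Phi : Continuous Phi :=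
  continuous_iff_continuousAt.2 fun x => (hasDerivAt_Phi x).continuousAt

theorem strictMono_Phi : StrictMono Phi :=
  strictMono_of_hasDerivAt_pos hasDerivAt_Phi fun x => gaussianPDFReal_pos 0 1 x one_ne_zero

theorem Phi_pos (x : ℝ) : 0 < Phi x :=
  (cdf_nonneg (gaussianReal 0 1) (x - 1)).trans_lt (strictMono_Phi (sub_one_lt x))

theorem Phi_lt_one (x : ℝ) : Phi x < 1 :=
  (strictMono_Phi (lt_add_one x)).trans_le (cdf_le_one (gaussianReal 0 1) (x + 1))

/-- The factor `φ / (Φ (1 - Φ))` of the probit score. -/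
def scoreWeight (z : ℝ) : ℝ := φ z / (Phi z * (1 - Phi z))

theorem scoreWeight_pos (z : ℝ) : 0 < scoreWeight z :=
  div_pos (gaussianPDFReal_pos 0 1 z one_ne_zero)
    (mul_pos (Phi_pos z) (sub_pos.2 (Phi_lt_one z)))

theorem continuous_scoreWeight : Continuous scoreWeight :=
  continuous_gaussianPDFReal.div (continuous_Phi.mul (continuous_const.sub continuous_Phi))
    fun z => (mul_pos (Phi_pos z) (sub_pos.2 (Phi_lt_one z))).ne'

/-- On bounded sets the mean probit score is strongly monotone. -/
theorem exists_mul_sq_le_scoreWeight_mul (R : ℝ) : ∃ κ > 0, ∀ z y : ℝ, |z| ≤ R → |y| ≤ R →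
    κ * (z - y) ^ 2 ≤ scoreWeight z * (Phi z - Phi y) * (z - y) := by
  rcases lt_or_ge R 0 with hR | hR
  · exact ⟨1, one_pos, fun z y hz => absurd ((abs_nonneg z).trans hz) hR.not_ge⟩
  have hne : (Set.Icc (-R) R).Nonempty := ⟨0, by simp [hR]⟩
  obtain ⟨z₁, -, h₁⟩ := isCompact_Icc.exists_isMinOn hne continuous_scoreWeight.continuousOn
  obtain ⟨z₂, -, h₂⟩ := isCompact_Icc.exists_isMinOn hne continuous_gaussianPDFReal.continuousOn
  have hp₁ := scoreWeight_pos z₁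
  have hp₂ := gaussianPDFReal_pos 0 1 z₂ one_ne_zero
  refine ⟨scoreWeight z₁ * φ z₂, mul_pos hp₁ hp₂, fun z y hz hy => ?_⟩
  have hmvt : ∀ p ∈ Set.Icc (-R) R, ∀ q ∈ Set.Icc (-R) R, p ≤ q →
      φ z₂ * (q - p) ≤ Phi q - Phi p := by
    apply (convex_Icc (-R) R).mul_sub_le_image_sub_of_le_deriv continuous_Phi.continuousOn
    · exact fun x _ => (hasDerivAt_Phi x).differentiableAt.differentiableWithinAt
    · intro x hx
      rw [(hasDerivAt_Phi x).deriv]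
      exact h₂ (interior_subset hx)
  have hw : scoreWeight z₁ ≤ scoreWeight z := h₁ (abs_le.1 hz)
  have key : φ z₂ * (z - y) ^ 2 ≤ (Phi z - Phi y) * (z - y) := by
    rcases le_total y z with h | h
    · nlinarith [hmvt y (abs_le.1 hy) z (abs_le.1 hz) h]
    · nlinarith [hmvt z (abs_le.1 hz) y (abs_le.1 hy) h]
  calc scoreWeight z₁ * φ z₂ * (z - y) ^ 2
      ≤ scoreWeight z * (φ z₂ * (z - y) ^ 2) := by
        rw [mul_assoc]; exact mul_le_mul_of_nonneg_right hw (by positivity)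
    _ ≤ scoreWeight z * (Phi z - Phi y) * (z - y) := by
        rw [mul_assoc]; exact mul_le_mul_of_nonneg_left key (scoreWeight_pos z).le

variable {n : ℕ}

/-- The covector `(-x, 1)`, whose pairing with `(A_i, c_i)` is `c_i - A_i x`. -/
def covector (x : Config n) : RowParam n :=
  WithLp.toLp 2 (Fin.snoc (α := fun _ => ℝ) (fun j => -realVec x j) 1)

theorem inner_covector (x : Config n) (η : RowParam n) :
    inner ℝ (covector x) η = η (Fin.last n) - ∑ j : Fin n, η j.castSucc * ((x j : ℕ) : ℝ) := by
  simp [covector, PiLp.inner_apply, Fin.sum_univ_castSucc, realVec]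
  ring

theorem inner_covector_vecParam (A : Matrix (Fin n) (Fin n) ℝ) (c : Fin n → ℝ) (i : Fin n)
    (x : Config n) :
    inner ℝ (covector x) (vecParam A c i) = c i - A.mulVec (realVec x) i := by
  rw [inner_covector]
  simp [vecParam, Matrix.mulVec, dotProduct, realVec]

/-- The weight `φ / (Φ (1 - Φ))` merges the two cases: the derivatives `φ / Φ` and `-φ / (1 - Φ)`
are this weight times `1 - Φ` and `-Φ`. -/
theorem hasDerivAt_log_likelihood (b : Fin 2) (z : ℝ) :
    HasDerivAt (fun z => Real.log ((1 - Phi z) ^ (b : ℕ) * Phi z ^ (1 - (b : ℕ))))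
      (scoreWeight z * (1 - Phi z - (b : ℕ))) z := by
  have h0 := (Phi_pos z).ne'
  have h1 := (sub_pos.2 (Phi_lt_one z)).ne'
  fin_cases b
  · have := (hasDerivAt_Phi z).log h0
    convert this using 1
    · simp
    simp only [Nat.cast_zero, sub_zero]
    rw [scoreWeight]; field_simp
  · have := ((hasDerivAt_Phi z).const_sub 1).log h1
    convert this using 1
    · simp
    simp only [Nat.cast_one]
    rw [scoreWeight]; field_simp; ring

theorem K_apply (θ : Param n) (s x : Config n) (i : Fin n) :
    K θ (Sum.elim s x) i = (scoreWeight (inner ℝ (covector x) (θ i)) *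
      (1 - Phi (inner ℝ (covector x) (θ i)) - ((s i : ℕ) : ℝ))) • covector x := by
  refine HasGradientAt.gradient ?_
  have h := (hasDerivAt_log_likelihood (s i) (inner ℝ (covector x) (θ i))).comp_hasFDerivAt (θ i)
    (innerSL ℝ (covector x)).hasFDerivAt
  rw [hasGradientAt_iff_hasFDerivAt]
  have hg : (fun η : RowParam n => Real.log (g i (Sum.elim s x) η)) =
      (fun z => Real.log ((1 - Phi z) ^ (s i : ℕ) * Phi z ^ (1 - (s i : ℕ)))) ∘
        (innerSL ℝ (covector x)) := by
    ext η
    simp only [g, Function.comp, Sum.elim_inl, Sum.elim_inr, innerSL_apply_apply, inner_covector]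
  rw [hg]
  refine h.congr_fderiv ?_
  ext η
  simp

end Probit

/-! ### Martingale convergence with square-summable increments. -/

section Martingale

variable {Ω : Type*} [mΩ : MeasurableSpace Ω] {μ : Measure Ω} [IsProbabilityMeasure μ]

/-- A martingale whose increments are bounded by a square-summable sequence converges. -/
theorem ae_tendsto_sum_of_condExp_eq_zero (𝓕 : Filtration ℕ mΩ) (X : ℕ → Ω → ℝ) (b : ℕ → ℝ)
    (hX : ∀ t, StronglyMeasurable[𝓕 (t + 1)] (X t)) (hb : ∀ t ω, |X t ω| ≤ b t)
    (hsum : Summable fun t => b t ^ 2) (hcond : ∀ t, μ[X t | 𝓕 t] =ᵐ[μ] 0) :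
    ∀ᵐ ω ∂μ, ∃ l, Tendsto (fun T => ∑ t ∈ Finset.range T, X t ω) atTop (𝓝 l) := by
  have hXm (t) : StronglyMeasurable (X t) := (hX t).mono (𝓕.le _)
  have hXL (t) : MemLp (X t) 2 μ :=
    MemLp.of_bound (hXm t).aestronglyMeasurable (b t) (ae_of_all _ (hb t))
  have hXi (t) : Integrable (X t) μ := (hXL t).integrable one_le_two
  set M : ℕ → Ω → ℝ := fun T ω => ∑ t ∈ Finset.range T, X t ω with hM
  have hMe (T) : M T = ∑ t ∈ Finset.range T, X t := by ext ω; simp [hM]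
  have hMad : StronglyAdapted 𝓕 M := fun T => by
    rw [hMe]
    exact Finset.stronglyMeasurable_sum _ fun t ht =>
      (hX t).mono (𝓕.mono (Finset.mem_range.1 ht))
  have hML (T) : MemLp (M T) 2 μ := memLp_finsetSum _ fun t _ => hXL t
  have hmart : Submartingale M 𝓕 μ := by
    refine submartingale_of_condExp_sub_nonneg_nat hMad
      (fun T => (hML T).integrable one_le_two) fun t => ?_
    have : M (t + 1) - M t = X t := by ext ω; simp [hM, Finset.sum_range_succ]
    rw [this]
    exact (hcond t).symm.le
  -- Increments are orthogonal to the past, so second moments add.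
  have hsq (T) : ∫ ω, M T ω ^ 2 ∂μ ≤ ∑ t ∈ Finset.range T, b t ^ 2 := by
    induction T with
    | zero => simp [hM]
    | succ T ih =>
      have hcross : ∫ ω, M T ω * X T ω ∂μ = 0 := by
        have h1 : μ[M T * X T | 𝓕 T] =ᵐ[μ] M T * μ[X T | 𝓕 T] :=
          condExp_mul_of_stronglyMeasurable_left (hMad T) ((hML T).integrable_mul (hXL T)) (hXi T)
        have h2 : μ[M T * X T | 𝓕 T] =ᵐ[μ] 0 := by
          filter_upwards [h1, hcond T] with ω h1 h2
          simp [h1, h2]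
        have h3 := integral_condExp (μ := μ) (𝓕.le T) (f := M T * X T)
        rw [integral_congr_ae h2] at h3
        simpa using h3.symm
      have hexp : ∀ ω, M (T + 1) ω ^ 2 = M T ω ^ 2 + 2 * (M T ω * X T ω) + X T ω ^ 2 := by
        intro ω; simp only [hM, Finset.sum_range_succ]; ring
      have i1 : Integrable (fun ω => M T ω ^ 2) μ := (hML T).integrable_sq
      have i2 : Integrable (fun ω => 2 * (M T ω * X T ω)) μ :=
        ((hML T).integrable_mul (hXL T)).const_mul 2
      have i3 : Integrable (fun ω => X T ω ^ 2) μ := (hXL T).integrable_sq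
      have h4 : ∫ ω, X T ω ^ 2 ∂μ ≤ b T ^ 2 := by
        calc ∫ ω, X T ω ^ 2 ∂μ ≤ ∫ _, b T ^ 2 ∂μ :=
              integral_mono i3 (integrable_const _) fun ω => sq_le_sq' (abs_le.1 (hb T ω)).1
                (abs_le.1 (hb T ω)).2
          _ = b T ^ 2 := by simp
      simp_rw [hexp]
      have i12 : Integrable (fun ω => M T ω ^ 2 + 2 * (M T ω * X T ω)) μ := i1.add i2
      rw [integral_add i12 i3, integral_add i1 i2, integral_const_mul, hcross,
        Finset.sum_range_succ]
      linarith
  -- Submartingale convergence needs an `L¹` bound; `|x| ≤ 1 + x ^ 2` supplies one.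
  have hbdd (T) : eLpNorm (M T) 1 μ ≤ ((1 + ∑' t, b t ^ 2).toNNReal : NNReal) := by
    rw [eLpNorm_one_eq_lintegral_enorm, ← ofReal_integral_norm_eq_lintegral_enorm
      ((hML T).integrable one_le_two)]
    refine ENNReal.ofReal_le_ofReal ?_
    calc ∫ ω, ‖M T ω‖ ∂μ ≤ ∫ ω, (1 + M T ω ^ 2) ∂μ := by
          refine integral_mono ((hML T).integrable one_le_two).norm
            ((integrable_const _).add (hML T).integrable_sq) fun ω => ?_
          simp only [Real.norm_eq_abs]
          nlinarith [sq_abs (M T ω), sq_nonneg (|M T ω| - 1)]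
      _ = 1 + ∫ ω, M T ω ^ 2 ∂μ := by
          rw [integral_add (integrable_const _) (hML T).integrable_sq]; simp
      _ ≤ 1 + ∑' t, b t ^ 2 := by
          gcongr
          exact (hsq T).trans (hsum.sum_le_tsum _ fun t _ => sq_nonneg _)
  filter_upwards [hmart.ae_tendsto_limitProcess hbdd] with ω h
  exact ⟨_, h⟩

/-- Convergence of a martingale transform of independent centred bounded variables. -/
theorem ae_tendsto_sum_mul_of_indep (𝓕 : Filtration ℕ mΩ) (W ζ : ℕ → Ω → ℝ) (b : ℕ → ℝ) (C : ℝ)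
    (hW : ∀ t, StronglyMeasurable[𝓕 t] (W t)) (hWb : ∀ t ω, |W t ω| ≤ b t)
    (hsum : Summable fun t => b t ^ 2)
    (hζ : ∀ t, StronglyMeasurable[𝓕 (t + 1)] (ζ t)) (hζb : ∀ t ω, |ζ t ω| ≤ C)
    (hζ0 : ∀ t, ∫ ω, ζ t ω ∂μ = 0)
    (hind : ∀ t, Indep (MeasurableSpace.comap (ζ t) inferInstance) (𝓕 t) μ) :
    ∀ᵐ ω ∂μ, ∃ l, Tendsto (fun T => ∑ t ∈ Finset.range T, W t ω * ζ t ω) atTop (𝓝 l) := by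
  have hle (t) : MeasurableSpace.comap (ζ t) inferInstance ≤ mΩ :=
    ((hζ t).mono (𝓕.le _)).measurable.comap_le
  refine ae_tendsto_sum_of_condExp_eq_zero 𝓕 (fun t => W t * ζ t) (fun t => b t * C)
    (fun t => ((hW t).mono (𝓕.mono t.le_succ)).mul (hζ t)) (fun t ω => ?_) ?_ fun t => ?_
  · rw [Pi.mul_apply, abs_mul]
    exact mul_le_mul (hWb t ω) (hζb t ω) (abs_nonneg _) ((abs_nonneg _).trans (hWb t ω))
  · simpa only [mul_pow] using hsum.mul_right _
  · have i1 : MemLp (W t) 2 μ := MemLp.of_bound ((hW t).mono (𝓕.le _)).aestronglyMeasurable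
      (b t) (ae_of_all _ (hWb t))
    have i2 : MemLp (ζ t) 2 μ := MemLp.of_bound ((hζ t).mono (𝓕.le _)).aestronglyMeasurable
      C (ae_of_all _ (hζb t))
    filter_upwards [condExp_mul_of_stronglyMeasurable_left (hW t) (i1.integrable_mul i2)
        (i2.integrable one_le_two),
      condExp_indep_eq (hle t) (𝓕.le t)
        (comap_measurable (ζ t)).stronglyMeasurable (hind t)] with ω h1 h2
    rw [h1, Pi.mul_apply, h2, hζ0]
    simp

/-- If `X` is independent of `(Y, Z)` and `Y` of `Z`, then `(X, Y)` is independent of `Z`. -/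
theorem indepFun_prodMk_of_indepFun {α β γ : Type*} [MeasurableSpace α] [MeasurableSpace β]
    [MeasurableSpace γ] {X : Ω → α} {Y : Ω → β} {Z : Ω → γ} (hX : Measurable X)
    (hY : Measurable Y) (hZ : Measurable Z) (h : IndepFun X (fun ω => (Y ω, Z ω)) μ)
    (h' : IndepFun Y Z μ) : IndepFun (fun ω => (X ω, Y ω)) Z μ := by
  have hXY : IndepFun X Y μ := h.comp measurable_id measurable_fst
  rw [indepFun_iff_map_prod_eq_prod_map_map (hX.prodMk hY).aemeasurable hZ.aemeasurable,
    hXY.map_prod_eq_prod_map_map hX.aemeasurable hY.aemeasurable]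
  have h1 := h.map_prod_eq_prod_map_map hX.aemeasurable (hY.prodMk hZ).aemeasurable
  rw [h'.map_prod_eq_prod_map_map hY.aemeasurable hZ.aemeasurable] at h1
  have := Measure.isProbabilityMeasure_map (μ := μ) hX.aemeasurable
  have := Measure.isProbabilityMeasure_map (μ := μ) hY.aemeasurable
  have := Measure.isProbabilityMeasure_map (μ := μ) hZ.aemeasurable
  have h2 := (measurePreserving_prodAssoc (μ.map X) (μ.map Y) (μ.map Z)).symm
  rw [← h2.map_eq, ← h1, Measure.map_map (MeasurableEquiv.measurable _) (by fun_prop)]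
  rfl

end Martingale

/-! ### The filtration of the noise. -/

section History

variable {n : ℕ} {Ω : Type*}

/-- The history `σ(S₀, D₁, …, D_t)`. -/
@[reducible]
def history (D : ℕ → Ω → Fin n → ℝ) (S₀ : Ω → Config n) (t : ℕ) : MeasurableSpace Ω :=
  MeasurableSpace.comap S₀ inferInstance ⊔
    ⨆ p ∈ Finset.range t ×ˢ (Finset.univ : Finset (Fin n)),
      MeasurableSpace.comap (fun ω => D (p.1 + 1) ω p.2) inferInstance

theorem history_mono (D : ℕ → Ω → Fin n → ℝ) (S₀ : Ω → Config n) : Monotone (history D S₀) := by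
  intro s t hst
  refine sup_le_sup_left (biSup_mono fun p hp => ?_) _
  simp only [Finset.mem_product, Finset.mem_range, Finset.mem_univ, and_true] at hp ⊢
  omega

variable {D : ℕ → Ω → Fin n → ℝ} {S₀ : Ω → Config n}

theorem history_le [mΩ : MeasurableSpace Ω] {μ : Measure Ω} (hD : IsStandardNormalNoise μ D) (hS₀ : IsInitialObservation μ D S₀) (t : ℕ) :
    history D S₀ t ≤ mΩ :=
  sup_le hS₀.measurable.comap_le
    (iSup₂_le fun p _ => (hD.measurable (p.1 + 1) (by omega) p.2).comap_le)

theorem measurable_history_noise (t : ℕ) : Measurable[history D S₀ (t + 1)] (D (t + 1)) := by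
  refine @measurable_pi_lambda _ _ _ (_) _ _ fun i => ?_
  rw [measurable_iff_comap_le]
  refine le_sup_of_le_right (le_iSup₂_of_le (t, i) ?_ le_rfl)
  simp

theorem measurable_history_initial (t : ℕ) : Measurable[history D S₀ t] S₀ := by
  rw [measurable_iff_comap_le]
  exact le_sup_left

theorem indep_noise_history [MeasurableSpace Ω] {μ : Measure Ω} [IsProbabilityMeasure μ]
    (hD : IsStandardNormalNoise μ D)
    (hS₀ : IsInitialObservation μ D S₀) (t : ℕ) :
    Indep (MeasurableSpace.comap (D (t + 1)) inferInstance) (history D S₀ t) μ := by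
  have hfm (p : ℕ × Fin n) : Measurable fun ω => D (p.1 + 1) ω p.2 :=
    hD.measurable (p.1 + 1) (by omega) p.2
  -- Index `p.1` stands for time `p.1 + 1`: `P` collects the times `1, …, t` and `Q` the time `t +
  -- 1`.
  let P : Finset (ℕ × Fin n) := Finset.range t ×ˢ Finset.univ
  let Q : Finset (ℕ × Fin n) := {t} ×ˢ Finset.univ
  have hPQ : Disjoint P Q := by
    rw [Finset.disjoint_left]
    simp only [P, Q, Finset.mem_product, Finset.mem_range, Finset.mem_singleton]
    intro p h h'
    omega
  have h1 := hD.indep.indepFun_finset P Q hPQ hfm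
  have h2 : IndepFun S₀ (fun ω => ((fun p : P => D (p.1.1 + 1) ω p.1.2),
      (fun p : Q => D (p.1.1 + 1) ω p.1.2))) μ :=
    hS₀.indep.comp (φ := id)
      (ψ := fun d : ℕ × Fin n → ℝ => ((fun p : P => d p), (fun p : Q => d p)))
      measurable_id (by fun_prop)
  have h3 := indepFun_prodMk_of_indepFun hS₀.measurable
    (measurable_pi_lambda _ fun p : P => hfm p) (measurable_pi_lambda _ fun p : Q => hfm p) h2 h1
  have h4 := (IndepFun_iff_Indep _ _ _).1 h3.symm
  refine indep_of_indep_of_le_left (indep_of_indep_of_le_right h4 ?_) ?_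
  · refine sup_le ?_ (iSup₂_le fun p hp => ?_)
    · rw [← measurable_iff_comap_le]
      exact measurable_fst.comp (comap_measurable _)
    · rw [← measurable_iff_comap_le]
      have e : Measurable fun d : P → ℝ => d ⟨p, hp⟩ := measurable_pi_apply _
      exact (e.comp measurable_snd).comp (comap_measurable _)
  · rw [← measurable_iff_comap_le]
    refine @measurable_pi_lambda _ _ _ (_) _ _ fun i => ?_
    have e : Measurable fun d : Q → ℝ => d ⟨(t, i), by simp [Q]⟩ := measurable_pi_apply _
    exact e.comp (comap_measurable _)

theorem map_noise [MeasurableSpace Ω] {μ : Measure Ω} (hD : IsStandardNormalNoise μ D) (t : ℕ) :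
    μ.map (D (t + 1)) = Measure.pi fun _ => gaussianReal 0 1 := by
  have h : iIndepFun (fun (i : Fin n) ω => D (t + 1) ω i) μ :=
    hD.indep.precomp (g := fun i : Fin n => (t, i)) fun i j h => by simpa using h
  have := h.map_fun_eq_pi_map fun i => (hD.measurable (t + 1) (by omega) i).aemeasurable
  simp_rw [hD.law (t + 1) (by omega)] at this
  exact this

end History

/-! ### Deterministic descent along one path. -/

section Descent

theorem exists_sum_range_le_of_tendsto {f : ℕ → ℝ} {l : ℝ}
    (h : Tendsto (fun T => ∑ t ∈ Finset.range T, f t) atTop (𝓝 l)) :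
    ∃ B, ∀ T, ∑ t ∈ Finset.range T, f t ≤ B :=
  h.bddAbove_range.imp fun _ hB T => hB ⟨T, rfl⟩

/-- If `L > 0`, then eventually `‖u t‖ ^ 2 > L / 2`, so `a t` is dominated by `2 / L` times a
summable term. -/
theorem tendsto_zero_of_summable_mul_norm_sq {E : Type*} [NormedAddCommGroup E] {u : ℕ → E}
    {a : ℕ → ℝ} {L : ℝ}
    (ha : ∀ t, 0 ≤ a t) (hna : ¬ Summable a)
    (hL : Tendsto (fun t => ‖u t‖ ^ 2) atTop (𝓝 L))
    (hs : Summable fun t => a t * ‖u t‖ ^ 2) : Tendsto u atTop (𝓝 0) := by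
  have hL0 : L = 0 := by
    by_contra hne
    have hpos : 0 < L := lt_of_le_of_ne
      (ge_of_tendsto' hL fun t => sq_nonneg ‖u t‖) (Ne.symm hne)
    refine hna (Summable.of_norm_bounded_eventually_nat (hs.mul_left (2 / L)) ?_)
    filter_upwards [hL.eventually (lt_mem_nhds (half_lt_self hpos))] with t ht
    rw [Real.norm_of_nonneg (ha t), div_mul_eq_mul_div, le_div_iff₀ hpos]
    nlinarith [mul_le_mul_of_nonneg_left ht.le (ha t)]
  rw [tendsto_zero_iff_norm_tendsto_zero]
  have := hL.sqrt
  simpa [hL0] using this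

variable {E : Type*} [NormedAddCommGroup E] [InnerProductSpace ℝ E]

/-- Pathwise descent argument: along a noisy gradient recursion whose noise contributes a
convergent series, the squared norm converges and the weighted squared residuals are summable. -/
theorem tendsto_norm_sq_and_summable_of_descent {u v : ℕ → E} {a h e : ℕ → ℝ} {κ C : ℝ}
    (hκ : 0 < κ) (ha : ∀ t, 0 ≤ a t) (hsum : Summable fun t => a t ^ 2)
    (hrec : ∀ t, u (t + 1) = u t - (a t * (h t + e t)) • v t)
    (hmono : ∀ t, κ * inner ℝ (v t) (u t) ^ 2 ≤ h t * inner ℝ (v t) (u t))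
    (hC : ∀ t, ‖(h t + e t) • v t‖ ≤ C)
    (hnoise : ∃ l, Tendsto
      (fun T => ∑ t ∈ Finset.range T, a t * inner ℝ (v t) (u t) * e t) atTop (𝓝 l)) :
    (∃ L, Tendsto (fun t => ‖u t‖ ^ 2) atTop (𝓝 L)) ∧
      Summable fun t => a t * inner ℝ (v t) (u t) ^ 2 := by
  obtain ⟨l, hl⟩ := hnoise
  set r : ℕ → ℝ := fun t => a t ^ 2 * ‖(h t + e t) • v t‖ ^ 2 with hr
  have hrs : Summable r := by
    refine Summable.of_nonneg_of_le (fun t => by positivity) (fun t => ?_) (hsum.mul_right (C ^ 2))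
    exact mul_le_mul_of_nonneg_left (pow_le_pow_left₀ (norm_nonneg _) (hC t) 2) (sq_nonneg _)
  have hstep (t) : ‖u (t + 1)‖ ^ 2 = ‖u t‖ ^ 2 - 2 * (a t * (h t * inner ℝ (v t) (u t))) -
      2 * (a t * inner ℝ (v t) (u t) * e t) + r t := by
    rw [hrec, norm_sub_sq_real, inner_smul_right, real_inner_comm, hr, mul_smul, norm_smul (a t),
      mul_pow, Real.norm_eq_abs, sq_abs]
    ring
  -- The telescoped recursion, with the nonnegative drift on the left. The right side converges,
  -- which bounds the drift sums; the convergent drift series then gives the limit of `‖u T‖ ^ 2`.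
  have hid (T : ℕ) : ‖u T‖ ^ 2 + 2 * ∑ t ∈ Finset.range T, a t * (h t * inner ℝ (v t) (u t)) =
      ‖u 0‖ ^ 2 - 2 * ∑ t ∈ Finset.range T, a t * inner ℝ (v t) (u t) * e t +
        ∑ t ∈ Finset.range T, r t := by
    induction T with
    | zero => simp
    | succ T ih =>
      simp only [Finset.sum_range_succ, hstep]
      linarith
  have hlim := ((hl.const_mul 2).const_sub (‖u 0‖ ^ 2)).add hrs.hasSum.tendsto_sum_nat
  have hnonneg (t) : 0 ≤ a t * (h t * inner ℝ (v t) (u t)) :=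
    mul_nonneg (ha t) ((by positivity : 0 ≤ κ * inner ℝ (v t) (u t) ^ 2).trans (hmono t))
  have hHs : Summable fun t => a t * (h t * inner ℝ (v t) (u t)) := by
    obtain ⟨B, hB⟩ := hlim.bddAbove_range
    refine summable_of_sum_range_le (c := B / 2) hnonneg fun T => ?_
    have h1 := hB ⟨T, rfl⟩
    have h2 := hid T
    dsimp only at h1
    nlinarith [sq_nonneg ‖u T‖]
  constructor
  · have hlim' := hlim.sub (hHs.hasSum.tendsto_sum_nat.const_mul 2)
    exact ⟨_, hlim'.congr fun T => by linarith [hid T]⟩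
  · refine Summable.of_nonneg_of_le (fun t => mul_nonneg (ha t) (sq_nonneg _)) (fun t => ?_)
      (hHs.mul_left κ⁻¹)
    have := mul_le_mul_of_nonneg_left (hmono t) (ha t)
    rw [← div_eq_inv_mul, le_div_iff₀ hκ]
    linarith

/-- Replacing `u (t + 1)` by `u t` in the weighted squared residuals keeps them summable. -/
theorem summable_inner_sq_shift {u v : ℕ → E} {a : ℕ → ℝ} {C : ℝ}
    (ha : ∀ t, 0 ≤ a t) (hsum : Summable fun t => a t ^ 2)
    (hu : ∀ t, ‖u (t + 1) - u t‖ ≤ C * a t) (hv : ∀ t, ‖v t‖ ≤ C)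
    (h : Summable fun t => a t * inner ℝ (v t) (u t) ^ 2) :
    Summable fun t => a (t + 1) * inner ℝ (v (t + 1)) (u t) ^ 2 := by
  have hC : 0 ≤ C := (norm_nonneg _).trans (hv 0)
  -- From `a ≤ 1 + a ^ 2`; no monotonicity of the steps is available.
  have haB (t) : a t ≤ 1 + ∑' t, a t ^ 2 := by
    have := hsum.le_tsum t fun _ _ => sq_nonneg _
    nlinarith [sq_nonneg (a t - 1)]
  refine Summable.of_nonneg_of_le (fun t => mul_nonneg (ha _) (sq_nonneg _)) (fun t => ?_)
    ((((summable_nat_add_iff 1).2 h).mul_left 2).add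
      (hsum.mul_left (2 * (1 + ∑' t, a t ^ 2) * C ^ 4)))
  have h1 : |inner ℝ (v (t + 1)) (u (t + 1) - u t)| ≤ C * (C * a t) :=
    (abs_real_inner_le_norm _ _).trans
      (mul_le_mul (hv _) (hu t) (norm_nonneg _) hC)
  rw [inner_sub_right] at h1
  have h2 := sq_le_sq' (abs_le.1 h1).1 (abs_le.1 h1).2
  set p : ℝ := inner ℝ (v (t + 1)) (u (t + 1))
  set q : ℝ := inner ℝ (v (t + 1)) (u t)
  have h3 : q ^ 2 ≤ 2 * p ^ 2 + 2 * (C ^ 4 * a t ^ 2) := by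
    nlinarith [sq_nonneg (2 * p - q)]
  calc a (t + 1) * q ^ 2 ≤ a (t + 1) * (2 * p ^ 2 + 2 * (C ^ 4 * a t ^ 2)) :=
        mul_le_mul_of_nonneg_left h3 (ha _)
    _ = 2 * (a (t + 1) * p ^ 2) + a (t + 1) * (2 * (C ^ 4 * a t ^ 2)) := by ring
    _ ≤ 2 * (a (t + 1) * p ^ 2) + (1 + ∑' t, a t ^ 2) * (2 * (C ^ 4 * a t ^ 2)) := by
        gcongr
        exact haB _
    _ = _ := by ring

/-- A compensator comparison: if the charges at the visits to a state are summable and that state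
has transition probability bounded below, then all charges are summable. -/
theorem summable_of_summable_mul_of_tendsto {w b p : ℕ → ℝ} {ε : ℝ} (hε : 0 < ε)
    (hw : ∀ t, 0 ≤ w t) (hp : ∀ t, ε ≤ p t) (hs : Summable fun t => w t * b t)
    (hl : ∃ l, Tendsto (fun T => ∑ t ∈ Finset.range T, w t * (b t - p t)) atTop (𝓝 l)) :
    Summable w := by
  obtain ⟨l, hl⟩ := hl
  have h := hs.hasSum.tendsto_sum_nat.sub hl
  simp_rw [← Finset.sum_sub_distrib] at h
  obtain ⟨B, hB⟩ := exists_sum_range_le_of_tendsto h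
  refine summable_of_sum_range_le (c := B / ε) hw fun T => ?_
  -- Termwise, `w * ε ≤ w * p = w * b - w * (b - p)`.
  rw [le_div_iff₀ hε, Finset.sum_mul]
  refine (Finset.sum_le_sum fun t _ => ?_).trans (hB T)
  nlinarith [mul_le_mul_of_nonneg_left (hp t) (hw t)]

end Descent

/-! ### Noise series along a driven finite chain. -/

section Driven

variable {Ω : Type*} [mΩ : MeasurableSpace Ω] {μ : Measure Ω} [IsProbabilityMeasure μ]
  {E : Type*} [NormedAddCommGroup E] [ProperSpace E] [MeasurableSpace E] [BorelSpace E]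
  {X Δ : Type*} [Finite X] [MeasurableSpace X] [DiscreteMeasurableSpace X] [MeasurableSpace Δ]

/-- For a finite Markov chain `x (t + 1) = q (x t) (d t)` driven by i.i.d. noise, the centred
increments of a function of the chain, weighted by square-summable steps and by a continuous
function of a bounded adapted process, have a convergent series. -/
theorem ae_tendsto_sum_of_driven (𝓕 : Filtration ℕ mΩ) {x : ℕ → Ω → X} {d : ℕ → Ω → Δ}
    {ν : Measure Δ} {q : X → Δ → X} {η : ℕ → Ω → E} (hq : ∀ y, Measurable (q y))
    (hstep : ∀ t ω, x (t + 1) ω = q (x t ω) (d t ω)) (hx : ∀ t, Measurable[𝓕 t] (x t))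
    (hd : ∀ t, Measurable[𝓕 (t + 1)] (d t))
    (hind : ∀ t, Indep (MeasurableSpace.comap (d t) inferInstance) (𝓕 t) μ)
    (hlaw : ∀ t, μ.map (d t) = ν) (hη : ∀ t, Measurable[𝓕 t] (η t))
    {f : E → X → ℝ} (hf : ∀ y, Continuous fun z => f z y) (ψ : X → ℝ)
    {b : ℕ → ℝ} (hb : Summable fun t => b t ^ 2) :
    ∀ᵐ ω ∂μ, (∃ M : ℝ, ∀ t, ‖η t ω‖ ≤ M) → ∃ l, Tendsto (fun T => ∑ t ∈ Finset.range T,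
      b t * f (η t ω) (x t ω) * (ψ (x (t + 1) ω) - ∫ z, ψ (q (x t ω) z) ∂ν)) atTop (𝓝 l) := by
  classical
  have := Fintype.ofFinite X
  have hψ : Measurable ψ := measurable_of_finite ψ
  have hdm (t) : Measurable (d t) := (hd t).mono (𝓕.le _) le_rfl
  have : IsProbabilityMeasure ν := hlaw 0 ▸ Measure.isProbabilityMeasure_map (hdm 0).aemeasurable
  obtain ⟨R, hR⟩ := (Set.finite_range fun y => |ψ y|).bddAbove
  replace hR (y) : |ψ y| ≤ R := hR ⟨y, rfl⟩
  have hint (y) : |∫ z, ψ (q y z) ∂ν| ≤ R := by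
    simpa using norm_integral_le_of_norm_le_const (μ := ν) (C := R)
      (f := fun z => ψ (q y z)) (ae_of_all _ fun z => hR (q y z))
  have hψq (y) : Measurable fun z => ψ (q y z) := hψ.comp (hq y)
  -- Freezing the state at `y` makes the centred factor a function of `d t` alone, hence independent
  -- of the past. Truncating to the ball of radius `N` makes the weight bounded.
  have key (N : ℕ) (y : X) : ∀ᵐ ω ∂μ, ∃ l, Tendsto (fun T => ∑ t ∈ Finset.range T,
      (b t * ((Metric.closedBall 0 (N : ℝ)).indicator (fun z => f z y) (η t ω) *
        (if x t ω = y then 1 else 0))) * (ψ (q y (d t ω)) - ∫ z, ψ (q y z) ∂ν)) atTop (𝓝 l) := by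
    obtain ⟨C, hC⟩ := (isCompact_closedBall (0 : E) N).exists_bound_of_continuousOn
      (hf y).continuousOn
    refine ae_tendsto_sum_mul_of_indep 𝓕 _ (fun t ω => ψ (q y (d t ω)) - ∫ z, ψ (q y z) ∂ν)
      (fun t => |b t| * |C|) (R + R) ?_ ?_ ?_ ?_ ?_ ?_ ?_
    · intro t
      refine (measurable_const.mul (Measurable.mul ?_ ?_)).stronglyMeasurable
      · exact ((hf y).measurable.indicator Metric.isClosed_closedBall.measurableSet).comp (hη t)
      · exact (measurable_of_finite fun y' : X => if y' = y then (1 : ℝ) else 0).comp (hx t)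
    · intro t ω
      rw [abs_mul]
      refine mul_le_mul_of_nonneg_left ?_ (abs_nonneg _)
      rw [abs_mul]
      have h1 : |(if x t ω = y then (1 : ℝ) else 0)| ≤ 1 := by split_ifs <;> simp
      have h2 : |(Metric.closedBall 0 (N : ℝ)).indicator (fun z => f z y) (η t ω)| ≤ |C| := by
        by_cases hz : η t ω ∈ Metric.closedBall 0 (N : ℝ)
        · rw [Set.indicator_of_mem hz]
          exact (hC _ hz).trans (le_abs_self C)
        · rw [Set.indicator_of_notMem hz]; simp
      simpa using mul_le_mul h2 h1 (abs_nonneg _) (abs_nonneg _)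
    · simpa only [mul_pow, sq_abs] using hb.mul_right (C ^ 2)
    · intro t
      exact (((hψq y).comp (hd t)).sub measurable_const).stronglyMeasurable
    · intro t ω
      exact (abs_sub _ _).trans (add_le_add (hR _) (hint y))
    · intro t
      have h1 : Integrable (fun z => ψ (q y z)) ν :=
        (integrable_const R).mono' (hψq y).aestronglyMeasurable
          (ae_of_all _ fun z => hR _)
      have h2 : ∫ ω, ψ (q y (d t ω)) ∂μ = ∫ z, ψ (q y z) ∂ν := by
        rw [← hlaw t, integral_map (hdm t).aemeasurable (hψq y).aestronglyMeasurable]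
      have h3 : Integrable (fun ω => ψ (q y (d t ω))) μ := by
        rw [← hlaw t] at h1
        exact h1.comp_measurable (hdm t)
      rw [integral_sub h3 (integrable_const _), h2]
      simp
    · intro t
      refine indep_of_indep_of_le_left (hind t) ?_
      rw [← measurable_iff_comap_le]
      exact ((hψq y).comp (comap_measurable (d t))).sub measurable_const
  -- On a path bounded by `M ≤ N` the truncation is inactive, and summing over the finitely many `y`
  -- restores the original series.
  filter_upwards [ae_all_iff.2 fun N => ae_all_iff.2 (key N)] with ω hω ⟨M, hM⟩
  obtain ⟨N, hN⟩ := exists_nat_ge M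
  choose l hl using hω N
  refine ⟨∑ y, l y, (tendsto_finsetSum Finset.univ fun y _ => hl y).congr fun T => ?_⟩
  rw [Finset.sum_comm]
  refine Finset.sum_congr rfl fun t _ => ?_
  rw [Finset.sum_eq_single (x t ω)]
  · rw [Set.indicator_of_mem (by simpa using (hM t).trans hN), if_pos rfl, hstep, mul_one]
  · intro y _ hy
    rw [if_neg hy.symm]; simp
  · simp

end Driven

/-! ### Transition probabilities of the chain. -/

section Transition

variable {n : ℕ} (A : Matrix (Fin n) (Fin n) ℝ) (c : Fin n → ℝ)

/-- The update map of the model: the next observation, given the present one and the noise. -/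
def transition (x : Config n) (z : Fin n → ℝ) : Config n :=
  quantizer (A.mulVec (realVec x) + z) c

theorem measurable_transition (x : Config n) : Measurable (transition A c x) := by
  refine measurable_pi_lambda _ fun i => ?_
  refine Measurable.ite ?_ measurable_const measurable_const
  exact measurableSet_lt measurable_const (measurable_const.add (measurable_pi_apply i))

/-- The law of the noise vector. -/
local notation "γ" => Measure.pi fun _ : Fin n => gaussianReal 0 1

/-- This identifies the compensator of the observation, so that the score is centred at the true
parameter. -/
theorem integral_transition_apply (x : Config n) (i : Fin n) :
    ∫ z, ((transition A c x z i : ℕ) : ℝ) ∂γ =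
      1 - Phi (inner ℝ (covector x) (vecParam A c i)) := by
  set y := inner ℝ (covector x) (vecParam A c i) with hy
  rw [inner_covector_vecParam] at hy
  have h1 : (fun z => ((transition A c x z i : ℕ) : ℝ)) =
      (Function.eval i ⁻¹' Set.Ioi y).indicator 1 := by
    ext z
    have : z ∈ Function.eval i ⁻¹' Set.Ioi y ↔ A.mulVec (realVec x) i + z i > c i := by
      simp only [Set.mem_preimage, Function.eval, Set.mem_Ioi, hy]
      constructor <;> intro h <;> linarith
    simp only [transition, quantizer, Pi.add_apply]
    split_ifs with h
    · rw [Set.indicator_of_mem (this.2 h)]; simp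
    · rw [Set.indicator_of_notMem (mt this.1 h)]; simp
  rw [h1, integral_indicator_one (measurable_pi_apply i measurableSet_Ioi), measureReal_def,
    (measurePreserving_eval (fun _ : Fin n => gaussianReal 0 1) i).measure_preimage
      measurableSet_Ioi.nullMeasurableSet, ← measureReal_def, Phi, cdf_eq_real, ← Set.compl_Iic,
    probReal_compl_eq_one_sub measurableSet_Iic]

/-- The Gaussian charges every half-line, so each transition has positive probability; finitely many
starting states make the bound uniform. -/
theorem exists_le_integral_transition_eq (s : Config n) : ∃ ε > 0, ∀ x : Config n,
    ε ≤ ∫ z, (if transition A c x z = s then (1 : ℝ) else 0) ∂γ := by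
  have hpos (x : Config n) : 0 < ∫ z, (if transition A c x z = s then (1 : ℝ) else 0) ∂γ := by
    have h1 : (fun z => if transition A c x z = s then (1 : ℝ) else 0) =
        (transition A c x ⁻¹' {s}).indicator 1 := by
      ext z
      split_ifs with h
      · rw [Set.indicator_of_mem (show z ∈ transition A c x ⁻¹' {s} from h), Pi.one_apply]
      · rw [Set.indicator_of_notMem (show z ∉ transition A c x ⁻¹' {s} from h)]
    rw [h1, integral_indicator_one (measurable_transition A c x (measurableSet_singleton s))]
    refine ENNReal.toReal_pos ?_ (measure_ne_top _ _)
    set y : Fin n → ℝ := fun i => c i - A.mulVec (realVec x) i with hy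
    -- A box of half-lines, whose mass factorizes over the coordinates.
    have h2 : Set.univ.pi (fun i => if s i = 1 then Set.Ioi (y i) else Set.Iic (y i)) ⊆
        transition A c x ⁻¹' {s} := by
      intro z hz
      rw [Set.mem_preimage, Set.mem_singleton_iff]
      ext1 i
      have hzi := hz i (Set.mem_univ i)
      simp only [transition, quantizer, Pi.add_apply]
      beta_reduce at hzi
      split_ifs at hzi with hs
      · rw [if_pos, hs]
        simp only [hy, Set.mem_Ioi] at hzi
        linarith
      · rw [if_neg]
        · omega
        · simp only [hy, Set.mem_Iic] at hzi
          linarith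
    refine (lt_of_lt_of_le ?_ (measure_mono h2)).ne'
    rw [Measure.pi_pi]
    refine pos_iff_ne_zero.2 (Finset.prod_ne_zero_iff.2 fun i _ h0 => ?_)
    have h0' := congrArg ENNReal.toReal h0
    split_ifs at h0'
    · rw [← Set.compl_Iic, ← measureReal_def, probReal_compl_eq_one_sub measurableSet_Iic,
        ← cdf_eq_real] at h0'
      have := Phi_lt_one (y i)
      rw [Phi] at this
      simp only [ENNReal.toReal_zero] at h0'
      linarith
    · rw [← measureReal_def, ← cdf_eq_real] at h0'
      exact (Phi_pos (y i)).ne' h0'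
  obtain ⟨x₀, h⟩ := Finite.exists_min fun x : Config n =>
    ∫ z, (if transition A c x z = s then (1 : ℝ) else 0) ∂γ
  exact ⟨_, hpos x₀, h⟩

end Transition

/-! ### The covectors span the row space. -/

section Covector

variable {n : ℕ}

/-- The covectors of the configurations span: residuals against all of them control the norm. -/
theorem summable_mul_norm_sq {u : ℕ → RowParam n} {a : ℕ → ℝ} (ha : ∀ t, 0 ≤ a t)
    (h : ∀ s : Config n, Summable fun t => a t * inner ℝ (covector s) (u t) ^ 2) :
    Summable fun t => a t * ‖u t‖ ^ 2 := by
  have h0 (t) : inner ℝ (covector (0 : Config n)) (u t) = u t (Fin.last n) := by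
    simp [inner_covector]
  -- The zero configuration reads off the threshold; subtracting the `j`-th unit configuration
  -- isolates the `j`-th weight.
  have h1 (t) (j : Fin n) : u t j.castSucc = inner ℝ (covector (0 : Config n)) (u t) -
      inner ℝ (covector (Pi.single j 1 : Config n)) (u t) := by
    rw [h0, inner_covector, Finset.sum_eq_single j]
    · simp
    · intro k _ hk
      simp [Pi.single_eq_of_ne hk]
    · simp
  have hk (k : Fin (n + 1)) : Summable fun t => a t * u t k ^ 2 := by
    induction k using Fin.lastCases with
    | last => simpa only [h0] using h 0
    | cast j =>
      refine Summable.of_nonneg_of_le (fun t => mul_nonneg (ha t) (sq_nonneg _)) (fun t => ?_)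
        (((h 0).add (h (Pi.single j 1))).mul_left 2)
      rw [h1, ← mul_add, mul_left_comm]
      refine mul_le_mul_of_nonneg_left ?_ (ha t)
      nlinarith [sq_nonneg (inner ℝ (covector (0 : Config n)) (u t) +
        inner ℝ (covector (Pi.single j 1 : Config n)) (u t))]
  refine (summable_sum fun k (_ : k ∈ Finset.univ) => hk k).congr fun t => ?_
  rw [EuclideanSpace.norm_sq_eq, Finset.mul_sum]
  simp

end Covector

theorem IsStepSize.not_summable {a : ℕ → ℝ} (ha : IsStepSize a) :
    ¬ Summable fun t => a (t + 2) := by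
  intro h
  have h' : Summable fun t => a (t + 1) := (summable_nat_add_iff (f := fun t => a (t + 1)) 1).1 h
  refine not_tendsto_nhds_of_tendsto_atTop ha.sum_eq_top _
    (h'.hasSum.tendsto_sum_nat.congr fun T => ?_)
  rw [Finset.range_eq_Ico, Finset.sum_Ico_add' a 0 T 1]
  rfl

/-! ### Adaptedness of observations and estimates. -/

section Adapted

variable {n : ℕ} {A : Matrix (Fin n) (Fin n) ℝ} {c : Fin n → ℝ} {Ω : Type*}
  {D Y : ℕ → Ω → Fin n → ℝ} {S : ℕ → Ω → Config n} {a : ℕ → ℝ} {θinit : Param n}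
  {θ : ℕ → Ω → Param n}

theorem IsBinaryModel.succ (hS : IsBinaryModel A c D Y S) (t : ℕ) (ω : Ω) :
    S (t + 1) ω = transition A c (S t ω) (D (t + 1) ω) := by
  rw [hS.observation (t + 1) (by omega), hS.state (t + 1) (by omega), transition,
    Nat.add_sub_cancel]

theorem IsBinaryModel.measurable_history (hS : IsBinaryModel A c D Y S) (t : ℕ) :
    Measurable[history D (S 0) t] (S t) := by
  induction t with
  | zero => exact measurable_history_initial 0
  | succ t ih =>
    have hq : Measurable fun p : Config n × (Fin n → ℝ) => transition A c p.1 p.2 :=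
      measurable_from_prod_countable_right fun x => measurable_transition A c x
    have h1 : Measurable[history D (S 0) (t + 1)] (S t) :=
      ih.mono (history_mono D (S 0) t.le_succ) le_rfl
    have h2 := hq.comp (h1.prodMk (measurable_history_noise t))
    rwa [show S (t + 1) = _ from funext (hS.succ t)]

theorem IsEstimate.succ_apply (hθ : IsEstimate a S θinit θ) (t : ℕ) (ω : Ω) (i : Fin n) :
    θ (t + 2) ω i = θ (t + 1) ω i +
      (a (t + 1) * (scoreWeight (inner ℝ (covector (S (t + 1) ω)) (θ (t + 1) ω i)) *
        (1 - Phi (inner ℝ (covector (S (t + 1) ω)) (θ (t + 1) ω i)) -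
          ((S (t + 2) ω i : ℕ) : ℝ)))) • covector (S (t + 1) ω) := by
  rw [hθ.step (t + 1) (by omega), Pi.add_apply, Pi.smul_apply, mul_smul]
  exact congrArg (fun k => θ (t + 1) ω i + a (t + 1) • k)
    (K_apply (θ (t + 1) ω) (S (t + 2) ω) (S (t + 1) ω) i)

theorem IsEstimate.measurable_history (hS : IsBinaryModel A c D Y S)
    (hθ : IsEstimate a S θinit θ) (i : Fin n) (t : ℕ) :
    Measurable[history D (S 0) (t + 1)] (fun ω => θ (t + 1) ω i) := by
  induction t with
  | zero =>
    simp only [zero_add, hθ.init]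
    exact measurable_const
  | succ t ih =>
    have hG : Measurable fun p : RowParam n × Config n × Config n =>
        p.1 + (a (t + 1) * (scoreWeight (inner ℝ (covector p.2.1) p.1) *
          (1 - Phi (inner ℝ (covector p.2.1) p.1) - ((p.2.2 i : ℕ) : ℝ)))) • covector p.2.1 := by
      have hv : Measurable fun p : RowParam n × Config n × Config n => covector p.2.1 :=
        (measurable_of_finite covector).comp (measurable_fst.comp measurable_snd)
      have hs : Measurable fun p : RowParam n × Config n × Config n => ((p.2.2 i : ℕ) : ℝ) :=
        (measurable_of_finite fun s : Config n => ((s i : ℕ) : ℝ)).comp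
          (measurable_snd.comp measurable_snd)
      have hz := hv.inner (𝕜 := ℝ) measurable_fst
      exact measurable_fst.add (((measurable_const.mul
        ((continuous_scoreWeight.measurable.comp hz).mul
          ((measurable_const.sub (continuous_Phi.measurable.comp hz)).sub hs)))).smul hv)
    have hm := history_mono D (S 0) (t + 1).le_succ
    have := hG.comp ((ih.mono hm le_rfl).prodMk
      (((hS.measurable_history (t + 1)).mono hm le_rfl).prodMk (hS.measurable_history (t + 2))))
    rwa [show (fun ω => θ (t + 1 + 1) ω i) = _ from funext fun ω => hθ.succ_apply t ω i]

end Adapted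

/-- The almost sure events are fixed before the bound `M` is introduced, so `M` may depend on the
path; the rest is deterministic. -/
theorem ae_tendsto_row {n : ℕ} {A : Matrix (Fin n) (Fin n) ℝ} {c : Fin n → ℝ}
    {Ω : Type*} [mΩ : MeasurableSpace Ω] {μ : Measure Ω} [IsProbabilityMeasure μ]
    {D Y : ℕ → Ω → Fin n → ℝ} {S : ℕ → Ω → Config n}
    (hD : IsStandardNormalNoise μ D) (hS₀ : IsInitialObservation μ D (S 0))
    (hS : IsBinaryModel A c D Y S) {a : ℕ → ℝ} (ha : IsStepSize a)
    {θinit : Param n} {θ : ℕ → Ω → Param n} (hθ : IsEstimate a S θinit θ) (i : Fin n) :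
    ∀ᵐ ω ∂μ, (∃ M : ℝ, ∀ t, ‖θ (t + 1) ω i‖ ≤ M) →
      Tendsto (fun t => θ t ω i) atTop (𝓝 (vecParam A c i)) := by
  classical
  set ϑ : RowParam n := vecParam A c i
  -- Time is shifted by one: at index `t` both `θ (t + 1)` and `S (t + 1)` are known, and `D (t +
  -- 2)` is the fresh noise.
  let 𝓕 : Filtration ℕ mΩ :=
    ⟨fun t => history D (S 0) (t + 1), fun s t h => history_mono D (S 0) (by omega),
      fun t => history_le hD hS₀ (t + 1)⟩
  have driven {f : RowParam n → Config n → ℝ} (hf : ∀ y, Continuous fun z => f z y)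
      (ψ : Config n → ℝ) {b : ℕ → ℝ} (hb : Summable fun t => b t ^ 2) :=
    ae_tendsto_sum_of_driven (μ := μ) 𝓕 (x := fun t => S (t + 1)) (d := fun t => D (t + 2))
      (ν := Measure.pi fun _ => gaussianReal 0 1) (η := fun t ω => θ (t + 1) ω i)
      (measurable_transition A c) (fun t ω => hS.succ (t + 1) ω)
      (fun t => hS.measurable_history (t + 1)) (fun t => measurable_history_noise (t + 1))
      (fun t => indep_noise_history hD hS₀ (t + 1)) (fun t => map_noise hD (t + 1))
      (fun t => hθ.measurable_history hS i t) hf ψ hb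
  have hsq : Summable fun t => a (t + 1) ^ 2 := ha.summable_sq
  have hsq' : Summable fun t => a (t + 2) ^ 2 := (summable_nat_add_iff 1).2 hsq
  have hpos (t) : 0 ≤ a (t + 1) := (ha.pos _ (by omega)).le
  have hnoise := driven (f := fun z y => scoreWeight (inner ℝ (covector y) z) *
      inner ℝ (covector y) (z - ϑ))
    (fun y => (continuous_scoreWeight.comp (by fun_prop)).mul (by fun_prop))
    (fun s => ((s i : ℕ) : ℝ)) hsq
  -- Compensated visits of `S (t + 2)` to `s`. The step is `a (t + 2)`, but the error is that of `θ
  -- (t + 1)`, known before the visit.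
  have hvisit := ae_all_iff.2 fun s : Config n =>
    driven (f := fun z _ => inner ℝ (covector s) (z - ϑ) ^ 2) (fun y => by fun_prop)
      (fun y => if y = s then 1 else 0) hsq'
  filter_upwards [hnoise, hvisit] with ω hnoise hvisit hM
  replace hnoise := hnoise hM
  replace hvisit := fun s => hvisit s hM
  obtain ⟨M, hM⟩ := hM
  obtain ⟨V, hV⟩ := (Set.finite_range fun y : Config n => ‖covector y‖).bddAbove
  replace hV (y : Config n) : ‖covector y‖ ≤ V := hV ⟨y, rfl⟩
  have hV0 : 0 ≤ V := (norm_nonneg _).trans (hV 0)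
  set R : ℝ := V * max M ‖ϑ‖
  have hRz (t) (y : Config n) : |inner ℝ (covector y) (θ (t + 1) ω i)| ≤ R :=
    (abs_real_inner_le_norm _ _).trans
      (mul_le_mul (hV y) ((hM t).trans (le_max_left _ _)) (norm_nonneg _) hV0)
  have hRϑ (y : Config n) : |inner ℝ (covector y) ϑ| ≤ R :=
    (abs_real_inner_le_norm _ _).trans
      (mul_le_mul (hV y) (le_max_right _ _) (norm_nonneg _) hV0)
  obtain ⟨κ, hκ, hmono⟩ := exists_mul_sq_le_scoreWeight_mul R
  obtain ⟨B, hB⟩ := (isCompact_Icc (a := -R) (b := R)).exists_bound_of_continuousOn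
    continuous_scoreWeight.continuousOn
  set u : ℕ → RowParam n := fun t => θ (t + 1) ω i - ϑ with hu
  set v : ℕ → RowParam n := fun t => covector (S (t + 1) ω) with hv
  set z : ℕ → ℝ := fun t => inner ℝ (v t) (θ (t + 1) ω i) with hz
  set y : ℕ → ℝ := fun t => inner ℝ (v t) ϑ with hy
  set h : ℕ → ℝ := fun t => scoreWeight (z t) * (Phi (z t) - Phi (y t)) with hh
  -- `h` is the score's conditional mean, up to sign, and `e` its centred remainder: `1 - Phi (y t)`
  -- is the true conditional mean of the observed bit.
  set e : ℕ → ℝ := fun t =>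
    scoreWeight (z t) * (((S (t + 2) ω i : ℕ) : ℝ) - (1 - Phi (y t))) with he
  have hzy (t) : inner ℝ (v t) (u t) = z t - y t := inner_sub_right _ _ _
  have hrec (t) : u (t + 1) = u t - (a (t + 1) * (h t + e t)) • v t := by
    have hcoef : a (t + 1) * (scoreWeight (z t) * (1 - Phi (z t) - ((S (t + 2) ω i : ℕ) : ℝ))) =
        -(a (t + 1) * (h t + e t)) := by
      simp only [hh, he]; ring
    have hη : θ (t + 2) ω i = θ (t + 1) ω i + (a (t + 1) * (scoreWeight (z t) *
        (1 - Phi (z t) - ((S (t + 2) ω i : ℕ) : ℝ)))) • v t := hθ.succ_apply t ω i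
    rw [hcoef, neg_smul, ← sub_eq_add_neg] at hη
    rw [show u (t + 1) = θ (t + 2) ω i - ϑ from rfl, hη, sub_right_comm]
  have hC (t) : ‖(h t + e t) • v t‖ ≤ |B| * V := by
    rw [norm_smul]
    refine mul_le_mul ?_ (hV _) (norm_nonneg _) (abs_nonneg _)
    have h1 : h t + e t = scoreWeight (z t) * (Phi (z t) - 1 + ((S (t + 2) ω i : ℕ) : ℝ)) := by
      simp only [hh, he]; ring
    have h2 : |Phi (z t) - 1 + ((S (t + 2) ω i : ℕ) : ℝ)| ≤ 1 := by
      have h3 := Phi_pos (z t)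
      have h4 := Phi_lt_one (z t)
      have h5 : ((S (t + 2) ω i : ℕ) : ℝ) ≤ 1 := by
        exact_mod_cast Nat.lt_succ_iff.1 (S (t + 2) ω i).isLt
      have h6 : (0 : ℝ) ≤ ((S (t + 2) ω i : ℕ) : ℝ) := Nat.cast_nonneg _
      exact abs_le.2 ⟨by linarith, by linarith⟩
    rw [h1, norm_mul]
    simpa using mul_le_mul ((hB (z t) (abs_le.1 (hRz t _))).trans (le_abs_self B)) h2
      (abs_nonneg _) (abs_nonneg _)
  obtain ⟨⟨L, hL⟩, hsum⟩ := tendsto_norm_sq_and_summable_of_descent (u := u) (v := v)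
    (a := fun t => a (t + 1)) (h := h) (e := e) hκ hpos hsq hrec
    (fun t => by rw [hzy]; exact hmono _ _ (hRz t _) (hRϑ _)) hC (by
      obtain ⟨l, hl⟩ := hnoise
      refine ⟨l, hl.congr fun T => Finset.sum_congr rfl fun t _ => ?_⟩
      rw [integral_transition_apply]
      simp only [he, hu, hv, hz, hy]
      ring)
  have hshift := summable_inner_sq_shift (u := u) (v := v) (a := fun t => a (t + 1))
    -- One constant serves both as increment bound and as covector bound.
    (C := max (|B| * V) V) hpos hsq (fun t => by
      have hCt := (hC t).trans (le_max_left (|B| * V) V)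
      rw [hrec, sub_sub_cancel_left, norm_neg, mul_smul, norm_smul, Real.norm_of_nonneg (hpos t),
        mul_comm]
      exact mul_le_mul_of_nonneg_right hCt (hpos t))
    (fun t => (hV _).trans (le_max_right _ _)) hsum
  have hall (s : Config n) : Summable fun t => a (t + 2) * inner ℝ (covector s) (u t) ^ 2 := by
    obtain ⟨ε, hε, hp⟩ := exists_le_integral_transition_eq A c s
    refine summable_of_summable_mul_of_tendsto hε
      (b := fun t => if S (t + 2) ω = s then 1 else 0)
      (fun t => mul_nonneg (hpos (t + 1)) (sq_nonneg _)) (fun t => hp (S (t + 1) ω)) ?_ (hvisit s)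
    refine Summable.of_nonneg_of_le (fun t => ?_) (fun t => ?_) hshift
    · exact mul_nonneg (mul_nonneg (hpos (t + 1)) (sq_nonneg _)) (by split_ifs <;> simp)
    · split_ifs with hs
      · simp only [hv, hs, mul_one, le_refl, show t + 1 + 1 = t + 2 from rfl]
      · rw [mul_zero]
        exact mul_nonneg (hpos (t + 1)) (sq_nonneg _)
  have hlim := tendsto_zero_of_summable_mul_norm_sq (fun t => hpos (t + 1)) ha.not_summable hL
    (summable_mul_norm_sq (fun t => hpos (t + 1)) hall)
  have := hlim.add_const ϑ
  simp only [hu, sub_add_cancel, zero_add] at this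
  exact (tendsto_add_atTop_iff_nat 1).1 this

end BinaryNetwork

end

theorem theorem5 {n : ℕ} (hn : 2 ≤ n)
    (A : Matrix (Fin n) (Fin n) ℝ) (c : Fin n → ℝ)
    (hA : ∀ i, 0 < ∑ j, |A i j|)
    {Ω : Type*} [MeasurableSpace Ω] (μ : MeasureTheory.Measure Ω)
    [MeasureTheory.IsProbabilityMeasure μ]
    (D Y : ℕ → Ω → Fin n → ℝ) (S : ℕ → Ω → BinaryNetwork.Config n)
    (hD : BinaryNetwork.IsStandardNormalNoise μ D)
    (hS₀ : BinaryNetwork.IsInitialObservation μ D (S 0))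
    (hS : BinaryNetwork.IsBinaryModel A c D Y S)
    (a : ℕ → ℝ) (ha : BinaryNetwork.IsStepSize a)
    (θinit : BinaryNetwork.Param n) (θ : ℕ → Ω → BinaryNetwork.Param n)
    (hθ : BinaryNetwork.IsEstimate a S θinit θ)
    (hbdd : ∀ᵐ ω ∂μ, ∃ M : ℝ, ∀ t, 1 ≤ t → ‖θ t ω‖ ≤ M) :
    ∀ᵐ ω ∂μ, Filter.Tendsto (fun t => θ t ω) Filter.atTop
      (nhds (BinaryNetwork.vecParam A c)) := by
  have hrow := ae_all_iff.2 fun i => BinaryNetwork.ae_tendsto_row hD hS₀ hS ha hθ i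
  filter_upwards [hrow, hbdd] with ω hrow ⟨M, hM⟩
  exact tendsto_pi_nhds.2 fun i =>
    hrow i ⟨M, fun t => (norm_le_pi_norm _ i).trans (hM (t + 1) (by omega))⟩
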